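/- Let $V$ be a finite set of $N$ sites, where site $v$ carries a spin with Hilbert space $\mathbb C^{d_v}$, $d_v\ge 1$. Let $H=\sum_{X\subseteq V}h_X$, where $h_X$ is a Hermitian operator acting on the sites of $X$. For a density matrix $\rho$ of the whole system and a region $X$, let $\rho_X=\mathrm{Tr}_{\overline X}\,\rho$ be the reduced density matrix, $S(\rho)=-\mathrm{Tr}(\rho\log\rho)$ the von Neumann entropy, $S(X|Y)=S(\rho_{X\cup Y})-S(\rho_Y)$ the conditional entropy, and $E(\rho)=\mathrm{Tr}(\rho H)$ the energy. Fix an arbitrary ordering of the sites and, for each site $k$, an arbitrary set of sites $\mathcal N_k$. Let $\mathcal M_k=\{<k\}\cap\mathcal N_k$, where $\{<k\}$ is the set of sites preceding $k$, and let $S_M(\rho)=\sum_k S(k|\mathcal M_k)$ be the Markov entropy. Fix a temperature $T\ge 0$. Let $\mathcal X$ be any collection of regions that contains every $X$ with $h_X\neq0$, every $\mathcal M_k$ and every $\{k\}\cup\mathcal M_k$. For a family $\{\rho_X\}_{X\in\mathcal X}$ of operators $\rho_X$ on the regions $X$ put $$F_M(\{\rho_X\})=\sum_{X\in\mathcal X}\mathrm{Tr}(\rho_Xh_X)-T\sum_k\bigl(S(\rho_{\{k\}\cup\mathcal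 M_k})-S(\rho_{\mathcal M_k})\bigr).$$ Let $\Omega$ be the set of families of the form $\rho_X=\mathrm{Tr}_{\overline X}\,\rho$, $X\in\mathcal X$, for one global density matrix $\rho$, and let $\tilde\Omega$ be the set of all families of density matrices that are locally consistent, i.e. for all $X,Y\in\mathcal X$ the operators $\rho_X$ and $\rho_Y$ have the same partial trace to $X\cap Y$. Then: 1. $S(\rho)\le S_M(\rho)$ for every density matrix $\rho$ of the whole system. 2. The minima $$F(T)=\min_\rho\{E(\rho)-TS(\rho)\},\qquad F_M(T)=\min_\rho\{E(\rho)-TS_M(\rho)\},\qquad F_{\rm MED}(T)=\min_{\{\rho_X\}\in\tilde\Omega}F_M(\{\rho_X\})$$ are attained, $F_M(T)=\min_{\{\rho_X\}\in\Omega}F_M(\{\rho_X\})$, $\Omega\subseteq\tilde\Omega$, and $$F_{\rm MED}(T)\le F_M(T)\le F(T).$$ 3. The minimisation that defines $F_{\rm MED}(T)$ is a convex problem with linear constraints: $\tilde\Omega$ is the intersection of the cone of families of positive semidefinite operators with a real affine subspace, and $F_M(\{\rho_X\})$ is a convex function on $\tilde\Omega$, and also on the cone of all locally consistent families of positive semidefinite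 operators (without the normalisation $\mathrm{Tr}\,\rho_X=1$). -/

import Mathlib

/-! # Quantum spin systems, von Neumann entropy and the Markov entropy decomposition

`V` is the finite set of sites; the spin at site `v` has Hilbert space `ℂ ^ (d v)`.
A region is a finite set of sites; operators on a region are complex matrices indexed by
the product basis of that region. -/

noncomputable section

namespace MED

open scoped ComplexOrder

/-- Labels of the product basis of the Hilbert space `⨂_{v ∈ X} ℂ ^ (d v)` of the region `X`. -/
abbrev Conf {V : Type*} (d : V → ℕ) (X : Finset V) : Type _ :=
  (v : {v // v ∈ X}) → Fin (d v.1)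

/-- Operators on the Hilbert space of the region `X`. -/
abbrev Op {V : Type*} (d : V → ℕ) (X : Finset V) : Type _ :=
  Matrix (Conf d X) (Conf d X) ℂ

section Operators

variable {V : Type*} [DecidableEq V] {d : V → ℕ}

/-- The basis label of `X` that is `a` on `Y ⊆ X` and `c` on `X \ Y`. -/
def glue {X Y : Finset V} (a : Conf d Y) (c : Conf d (X \ Y)) : Conf d X :=
  fun v => if h : v.1 ∈ Y then a ⟨v.1, h⟩ else c ⟨v.1, Finset.mem_sdiff.mpr ⟨v.2, h⟩⟩

/-- The restriction to `Y ⊆ X` of a basis label of `X`. -/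
def restrict {X Y : Finset V} (hYX : Y ⊆ X) (x : Conf d X) : Conf d Y :=
  fun v => x ⟨v.1, hYX v.2⟩

/-- The partial trace over `X \ Y` of an operator on `X`, an operator on `Y`. It is meaningful
only for `Y ⊆ X`, which is therefore an argument. -/
def ptrace {X Y : Finset V} (_hYX : Y ⊆ X) (ρ : Op d X) : Op d Y :=
  fun a b => ∑ c : Conf d (X \ Y), ρ (glue a c) (glue b c)

/-- The operator `A ⊗ 𝟙` on the region `X`, where `A` acts on `Y ⊆ X` and the identity on
`X \ Y`. -/
def extend {X Y : Finset V} (hYX : Y ⊆ X) (A : Op d Y) : Op d X :=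
  fun x y => A (restrict hYX x) (restrict hYX y) *
    (1 : Op d (X \ Y)) (restrict Finset.sdiff_subset x) (restrict Finset.sdiff_subset y)

/-- Density matrices: positive semidefinite of trace one. -/
def IsDensity {X : Finset V} (ρ : Op d X) : Prop :=
  ρ.PosSemidef ∧ ρ.trace = 1

/-- The von Neumann entropy `S(ρ) = - Tr (ρ log ρ)`, where the logarithm is taken by the
functional calculus; the convention `Real.log 0 = 0` gives the usual `0 log 0 = 0`. -/
def entropy {X : Finset V} (ρ : Op d X) : ℝ :=
  - (ρ * cfc Real.log ρ).trace.re

end Operators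

section Global

variable {V : Type*} [Fintype V] [DecidableEq V] {d : V → ℕ}

/-- The reduced density matrix on `X` of a state `ρ` of the whole system. -/
def reduced (ρ : Op d Finset.univ) (X : Finset V) : Op d X :=
  ptrace (Finset.subset_univ X) ρ

/-- The conditional entropy `S(X | Y) = S(X ∪ Y) - S(Y)` in the state `ρ`. -/
def condEntropy (ρ : Op d Finset.univ) (X Y : Finset V) : ℝ :=
  entropy (reduced ρ (X ∪ Y)) - entropy (reduced ρ Y)

/-- The Hamiltonian `H = ∑_X h_X`, each `h_X` acting on the region `X`. -/
def hamiltonian (h : (X : Finset V) → Op d X) : Op d Finset.univ :=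
  ∑ X : Finset V, extend (Finset.subset_univ X) (h X)

/-- The average energy `E(ρ) = Tr (ρ H)`. -/
def energy (h : (X : Finset V) → Op d X) (ρ : Op d Finset.univ) : ℝ :=
  (ρ * hamiltonian h).trace.re

/-- The sites `{< k}` preceding `k` in the ordering `ord`. -/
def preceding {N : ℕ} (ord : V ≃ Fin N) (k : V) : Finset V :=
  Finset.univ.filter fun j => ord j < ord k

/-- The Markov shield `M_k = {< k} ∩ N_k` of the site `k`, where `N_k = nbhd k`. -/
def shield {N : ℕ} (ord : V ≃ Fin N) (nbhd : V → Finset V) (k : V) : Finset V :=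
  preceding ord k ∩ nbhd k

/-- The Markov entropy `S_M(ρ) = ∑_k S(k | M_k)`. -/
def markovEntropy {N : ℕ} (ord : V ≃ Fin N) (nbhd : V → Finset V)
    (ρ : Op d Finset.univ) : ℝ :=
  ∑ k : V, condEntropy ρ {k} (shield ord nbhd k)

/-- The values `E(ρ) - T S(ρ)` over all states `ρ`. -/
def freeEnergyValues (h : (X : Finset V) → Op d X) (T : ℝ) : Set ℝ :=
  (fun ρ : Op d Finset.univ => energy h ρ - T * entropy ρ) '' {ρ | IsDensity ρ}

/-- The free energy `F(T)`. -/
def freeEnergy (h : (X : Finset V) → Op d X) (T : ℝ) : ℝ :=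
  sInf (freeEnergyValues h T)

/-- The values `E(ρ) - T S_M(ρ)` over all states `ρ`. -/
def markovFreeEnergyValues {N : ℕ} (h : (X : Finset V) → Op d X) (ord : V ≃ Fin N)
    (nbhd : V → Finset V) (T : ℝ) : Set ℝ :=
  (fun ρ : Op d Finset.univ => energy h ρ - T * markovEntropy ord nbhd ρ) '' {ρ | IsDensity ρ}

/-- The Markov free energy `F_M(T)`. -/
def markovFreeEnergy {N : ℕ} (h : (X : Finset V) → Op d X) (ord : V ≃ Fin N)
    (nbhd : V → Finset V) (T : ℝ) : ℝ :=
  sInf (markovFreeEnergyValues h ord nbhd T)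

end Global

section Families

variable {V : Type*} [Fintype V] [DecidableEq V]

/-- Families `{ρ_X}` of operators, one for each region `X` of the collection `𝒳`. -/
abbrev Family (d : V → ℕ) (𝒳 : Finset (Finset V)) : Type _ :=
  (X : {X // X ∈ 𝒳}) → Op d X.1

/-- The collection `𝒳` suffices to evaluate the energy and the Markov entropy: it contains the
support of every interaction term, every Markov shield, and every shield joined with its site. -/
structure Suffices {d : V → ℕ} {N : ℕ} (𝒳 : Finset (Finset V)) (h : (X : Finset V) → Op d X)
    (ord : V ≃ Fin N) (nbhd : V → Finset V) : Prop where
  support_mem : ∀ X, h X ≠ 0 → X ∈ 𝒳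
  shield_mem : ∀ k, shield ord nbhd k ∈ 𝒳
  site_union_shield_mem : ∀ k, {k} ∪ shield ord nbhd k ∈ 𝒳

variable {d : V → ℕ} {𝒳 : Finset (Finset V)}

/-- Any two members have the same partial trace to the overlap of their regions. -/
def LocallyConsistent (ρ : Family d 𝒳) : Prop :=
  ∀ X Y, ptrace (Y := X.1 ∩ Y.1) Finset.inter_subset_left (ρ X) =
    ptrace (Y := X.1 ∩ Y.1) Finset.inter_subset_right (ρ Y)

variable (d 𝒳) in
/-- The cone of families of positive semidefinite operators. -/
def psdCone : Set (Family d 𝒳) :=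
  {ρ | ∀ X, (ρ X).PosSemidef}

variable (d 𝒳) in
/-- The set `Ω` of families of reduced density matrices of one global state. -/
def consistentFamilies : Set (Family d 𝒳) :=
  {ρ | ∃ σ : Op d Finset.univ, IsDensity σ ∧ ∀ X, ρ X = reduced σ X.1}

variable (d 𝒳) in
/-- The set `Ω̃` of locally consistent families of density matrices. -/
def locallyConsistentFamilies : Set (Family d 𝒳) :=
  {ρ | (∀ X, IsDensity (ρ X)) ∧ LocallyConsistent ρ}

variable {N : ℕ} {h : (X : Finset V) → Op d X} {ord : V ≃ Fin N} {nbhd : V → Finset V}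

/-- The energy `∑_X Tr (ρ_X h_X)` of a family. -/
def familyEnergy (h : (X : Finset V) → Op d X) (ρ : Family d 𝒳) : ℝ :=
  ∑ X, (ρ X * h X.1).trace.re

/-- The Markov entropy `∑_k (S(ρ_{k ∪ M_k}) - S(ρ_{M_k}))` of a family. -/
def familyMarkovEntropy (hs : Suffices 𝒳 h ord nbhd) (ρ : Family d 𝒳) : ℝ :=
  ∑ k : V, (entropy (ρ ⟨{k} ∪ shield ord nbhd k, hs.site_union_shield_mem k⟩) -
    entropy (ρ ⟨shield ord nbhd k, hs.shield_mem k⟩))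

/-- The Markov free energy `F_M({ρ_X}) = E - T S_M` of a family at temperature `T`. -/
def familyMarkovFreeEnergy (hs : Suffices 𝒳 h ord nbhd) (T : ℝ) (ρ : Family d 𝒳) : ℝ :=
  familyEnergy h ρ - T * familyMarkovEntropy hs ρ

/-- `F_MED(T)`, the minimum of the Markov free energy over locally consistent families. -/
def medFreeEnergy (hs : Suffices 𝒳 h ord nbhd) (T : ℝ) : ℝ :=
  sInf (familyMarkovFreeEnergy hs T '' locallyConsistentFamilies d 𝒳)

end Families

end MED

end

noncomputable section

namespace MED

open scoped ComplexOrder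
open Matrix Filter Topology

/-! ### Relative entropy: variational integral formula and its consequences -/

section RelativeEntropy

/-! Everything rests on two properties of the relative entropy D(A‖B), joint convexity and
monotonicity under partial traces, both read off from one formula. For positive definite A, B,
D(A‖B) = Tr(A - B) + ∫₀¹ s q_s(A, B) ds, where q_s(A, B) is the maximum over matrices X of `quadTest
s A B X`, which is real-linear in (A, B) (`relEntropy_eq_integral`, `quadTest_le_quadSup`,
`exists_quadTest_eq_quadSup`). A maximum of linear functionals is subadditive, whence
`relEntropy_add_le`; and X ↦ X ⊗ 𝟙 lifts test operators for the partial traces to test operators for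
A, B, whence `relEntropy_ptrace_le`.

With B = ρ_Y ⊗ 𝟙 and A = ρ_X, Y ⊆ X, D equals S(ρ_Y) - S(ρ_X), minus a conditional entropy.
Monotonicity then becomes `strong_subadditivity`, and joint subadditivity together with homogeneity
of degree one makes the conditional entropy concave on the whole positive semidefinite cone.
Singular matrices are reached by continuity.

The chain rule writes S(ρ) as ∑ₖ S(k | <k), and strong subadditivity shrinks each condition to the
shield, so S ≤ S_M. In a locally consistent family ρ_{M_k} is the partial trace of ρ_{k ∪ M_k}, so
every term of S_M is a true conditional entropy, hence concave, while the energy is linear. The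
minima are attained by compactness and continuity; their order follows from Ω ⊆ Ω̃ and from S ≤ S_M
with T ≥ 0. -/

theorem sum_integral {ι : Type*} [Fintype ι] (w : ι → ι → ℝ) (f : ι → ι → ℝ → ℝ)
    (hf : ∀ i j, IntervalIntegrable (f i j) MeasureTheory.volume 0 1) :
    ∫ s in (0 : ℝ)..1, ∑ i, ∑ j, w i j * f i j s =
      ∑ i, ∑ j, w i j * ∫ s in (0 : ℝ)..1, f i j s := by
  rw [intervalIntegral.integral_finsetSum fun i _ => ?_]
  · refine Finset.sum_congr rfl fun i _ => ?_
    rw [intervalIntegral.integral_finsetSum fun j _ => (hf i j).const_mul _]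
    simp only [intervalIntegral.integral_const_mul]
  · have := IntervalIntegrable.sum Finset.univ fun j _ => (hf i j).const_mul (w i j)
    convert! this using 1
    ext s
    simp

variable {n : Type*} [Fintype n] [DecidableEq n]

/-- The relative entropy `Tr A (log A - log B)` of two matrices. -/
def relEntropy (A B : Matrix n n ℂ) : ℝ :=
  (A * cfc Real.log A).trace.re - (A * cfc Real.log B).trace.re

/-- The linear functional of `(A, B)` whose supremum over `X` is the integrand of the integral
representation of the relative entropy. -/
def quadTest (s : ℝ) (A B X : Matrix n n ℂ) : ℝ :=
  2 * (Xᴴ * (A - B)).trace.re - (1 - s) * (Xᴴ * A * X).trace.re - s * (X * B * Xᴴ).trace.re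

/-- The supremum of `quadTest s A B`, in terms of the spectral decompositions of `A` and `B`. -/
def quadSup {A B : Matrix n n ℂ} (hA : A.IsHermitian) (hB : B.IsHermitian) (s : ℝ) : ℝ :=
  ∑ i, ∑ j, Complex.normSq ((star (hA.eigenvectorUnitary : Matrix n n ℂ) *
    (hB.eigenvectorUnitary : Matrix n n ℂ)) i j) *
    ((hA.eigenvalues i - hB.eigenvalues j) ^ 2 /
      ((1 - s) * hA.eigenvalues i + s * hB.eigenvalues j))

/-- Expanding in the two eigenbases leaves only the squared overlaps |⟨uᵢ, wⱼ⟩|² as weights. This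
reduces statements about noncommuting A and B to scalar ones about pairs of eigenvalues. -/
theorem trace_cfc_mul_cfc {A B : Matrix n n ℂ} (hA : A.IsHermitian) (hB : B.IsHermitian)
    (f g : ℝ → ℝ) :
    (cfc f A * cfc g B).trace.re =
      ∑ i, ∑ j, Complex.normSq ((star (hA.eigenvectorUnitary : Matrix n n ℂ) *
        (hB.eigenvectorUnitary : Matrix n n ℂ)) i j) *
        (f (hA.eigenvalues i) * g (hB.eigenvalues j)) := by
  rw [hA.cfc_eq, hB.cfc_eq]
  simp only [Matrix.IsHermitian.cfc, Unitary.conjStarAlgAut_apply]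
  set U : Matrix n n ℂ := (hA.eigenvectorUnitary : Matrix n n ℂ)
  set W : Matrix n n ℂ := (hB.eigenvectorUnitary : Matrix n n ℂ)
  have key : (U * diagonal (RCLike.ofReal ∘ f ∘ hA.eigenvalues) * star U *
      (W * diagonal (RCLike.ofReal ∘ g ∘ hB.eigenvalues) * star W)).trace =
      (diagonal (RCLike.ofReal ∘ f ∘ hA.eigenvalues) * (star U * W) *
        diagonal (RCLike.ofReal ∘ g ∘ hB.eigenvalues) * (star U * W)ᴴ).trace := by
    simp only [← star_eq_conjTranspose, star_mul, star_star, mul_assoc]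
    rw [trace_mul_comm U]
    simp only [mul_assoc]
  erw [key]
  generalize star U * W = M
  simp only [trace, diag_apply, mul_apply (M := _ * diagonal _), mul_diagonal, diagonal_mul,
    conjTranspose_apply, Complex.re_sum]
  refine Finset.sum_congr rfl fun i _ => Finset.sum_congr rfl fun j _ => ?_
  simp [Complex.normSq_apply]
  ring

theorem spectral_eq {A : Matrix n n ℂ} (hA : A.IsHermitian) :
    A = (hA.eigenvectorUnitary : Matrix n n ℂ) *
      diagonal (fun i => (hA.eigenvalues i : ℂ)) *
      star (hA.eigenvectorUnitary : Matrix n n ℂ) := by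
  conv_lhs => rw [hA.spectral_theorem, Unitary.conjStarAlgAut_apply]
  rfl

/-- Reading the test operator between the eigenbases of A and B decouples its entries, so the
maximisation over matrices becomes independent scalar quadratics. -/
theorem quadTest_eq {A B : Matrix n n ℂ} (hA : A.IsHermitian) (hB : B.IsHermitian) (s : ℝ)
    (Y : Matrix n n ℂ) :
    quadTest s A B ((hA.eigenvectorUnitary : Matrix n n ℂ) * Y *
      star (hB.eigenvectorUnitary : Matrix n n ℂ)) =
      ∑ i, ∑ j, (2 * (star (Y i j) * (star (hA.eigenvectorUnitary : Matrix n n ℂ) *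
        (hB.eigenvectorUnitary : Matrix n n ℂ)) i j).re *
          (hA.eigenvalues i - hB.eigenvalues j) -
        ((1 - s) * hA.eigenvalues i + s * hB.eigenvalues j) * Complex.normSq (Y i j)) := by
  have eA := spectral_eq hA
  have eB := spectral_eq hB
  have hU : star (hA.eigenvectorUnitary : Matrix n n ℂ) * hA.eigenvectorUnitary = 1 :=
    Unitary.coe_star_mul_self _
  have hW : star (hB.eigenvectorUnitary : Matrix n n ℂ) * hB.eigenvectorUnitary = 1 :=
    Unitary.coe_star_mul_self _
  set U : Matrix n n ℂ := (hA.eigenvectorUnitary : Matrix n n ℂ)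
  set W : Matrix n n ℂ := (hB.eigenvectorUnitary : Matrix n n ℂ)
  set a := hA.eigenvalues
  set b := hB.eigenvalues
  set DA : Matrix n n ℂ := diagonal fun i => (a i : ℂ) with hDA
  set DB : Matrix n n ℂ := diagonal fun i => (b i : ℂ) with hDB
  have hU' : ∀ Z, star U * (U * Z) = Z := fun Z => by rw [← mul_assoc, hU, one_mul]
  have hW' : ∀ Z, star W * (W * Z) = Z := fun Z => by rw [← mul_assoc, hW, one_mul]
  have h1 : ((U * Y * star W)ᴴ * (A - B)).trace =
      (star Y * (DA * (star U * W) - (star U * W) * DB)).trace := by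
    simp only [← star_eq_conjTranspose, star_mul, star_star]
    rw [eA, eB, mul_assoc W, trace_mul_comm W]
    simp only [mul_sub, sub_mul, mul_assoc, hU', hW, mul_one]
  have h2 : ((U * Y * star W)ᴴ * A * (U * Y * star W)).trace = (star Y * (DA * Y)).trace := by
    simp only [← star_eq_conjTranspose, star_mul, star_star]
    rw [eA]
    simp only [mul_assoc, hU']
    rw [trace_mul_comm W]
    simp only [mul_assoc, hW, mul_one]
  have h3 : ((U * Y * star W) * B * (U * Y * star W)ᴴ).trace = (Y * DB * star Y).trace := by
    simp only [← star_eq_conjTranspose, star_mul, star_star]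
    rw [eB]
    simp only [mul_assoc, hW']
    rw [trace_mul_comm U]
    simp only [mul_assoc, hU, mul_one]
  have swap : ∀ F : n → n → ℝ, ∑ j, ∑ i, F i j = ∑ i, ∑ j, F i j := fun F => Finset.sum_comm
  rw [quadTest, h1, h2, h3]
  generalize star U * W = M
  simp only [trace, diag_apply, mul_apply (M := star Y), mul_apply (N := star Y),
    Matrix.sub_apply, hDA, hDB, mul_diagonal, diagonal_mul, star_apply, Complex.re_sum]
  rw [swap (fun i j => (star (Y i j) * (↑(a i) * M i j - M i j * ↑(b j))).re),
    swap (fun i j => (star (Y i j) * (↑(a i) * Y i j)).re)]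
  simp only [Finset.mul_sum, ← Finset.sum_sub_distrib]
  refine Finset.sum_congr rfl fun i _ => Finset.sum_congr rfl fun j _ => ?_
  simp [Complex.normSq_apply]
  ring

theorem denom_pos {a b s : ℝ} (ha : 0 < a) (hb : 0 < b) (hs : s ∈ Set.Icc (0 : ℝ) 1) :
    0 < (1 - s) * a + s * b := by
  rcases hs.1.eq_or_lt with h | h
  · simpa [← h] using ha
  · have := mul_pos h hb
    have := mul_nonneg (sub_nonneg.2 hs.2) ha.le
    linarith

theorem quadTest_le_quadSup {A B : Matrix n n ℂ} (hA : A.PosDef) (hB : B.PosDef) {s : ℝ}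
    (hs : s ∈ Set.Icc (0 : ℝ) 1) (X : Matrix n n ℂ) :
    quadTest s A B X ≤ quadSup hA.1 hB.1 s := by
  set U : Matrix n n ℂ := (hA.1.eigenvectorUnitary : Matrix n n ℂ) with hU
  set W : Matrix n n ℂ := (hB.1.eigenvectorUnitary : Matrix n n ℂ) with hW
  have hX : X = U * (star U * X * W) * star W := by
    have h1 : U * star U = 1 := Unitary.coe_mul_star_self _
    have h2 : W * star W = 1 := Unitary.coe_mul_star_self _
    simp only [mul_assoc, h2, mul_one]
    rw [← mul_assoc, h1, one_mul]
  rw [hX, quadTest_eq, quadSup]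
  refine Finset.sum_le_sum fun i _ => Finset.sum_le_sum fun j _ => ?_
  have hd := denom_pos (hA.eigenvalues_pos i) (hB.eigenvalues_pos j) hs
  simp only [← hU, ← hW]
  generalize (star U * X * W) i j = y
  generalize (star U * W) i j = m
  generalize (1 - s) * hA.1.eigenvalues i + s * hB.1.eigenvalues j = t at *
  generalize hA.1.eigenvalues i - hB.1.eigenvalues j = c
  rw [← mul_div_assoc, le_div_iff₀ hd]
  simp only [Complex.normSq_apply, Complex.mul_re, Complex.star_def, Complex.conj_re,
    Complex.conj_im]
  -- Completing the square: the two hints add up to |c m - t y|² ≥ 0.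
  nlinarith [sq_nonneg (c * m.re - t * y.re), sq_nonneg (c * m.im - t * y.im)]

theorem exists_quadTest_eq_quadSup {A B : Matrix n n ℂ} (hA : A.PosDef) (hB : B.PosDef) {s : ℝ}
    (hs : s ∈ Set.Icc (0 : ℝ) 1) :
    ∃ X : Matrix n n ℂ, quadTest s A B X = quadSup hA.1 hB.1 s := by
  set M : Matrix n n ℂ := star (hA.1.eigenvectorUnitary : Matrix n n ℂ) *
    (hB.1.eigenvectorUnitary : Matrix n n ℂ) with hM
  -- The entries are the critical points of the scalar quadratics, where the completed square
  -- vanishes.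
  refine ⟨_, (quadTest_eq hA.1 hB.1 s (of fun i j =>
    (((hA.1.eigenvalues i - hB.1.eigenvalues j) /
      ((1 - s) * hA.1.eigenvalues i + s * hB.1.eigenvalues j) : ℝ) : ℂ) * M i j)).trans ?_⟩
  rw [quadSup]
  refine Finset.sum_congr rfl fun i _ => Finset.sum_congr rfl fun j _ => ?_
  have hd := denom_pos (hA.eigenvalues_pos i) (hB.eigenvalues_pos j) hs
  rw [← hM, of_apply]
  generalize M i j = m
  generalize (1 - s) * hA.1.eigenvalues i + s * hB.1.eigenvalues j = t at *
  generalize hA.1.eigenvalues i - hB.1.eigenvalues j = c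
  simp only [Complex.normSq_apply, Complex.mul_re, Complex.mul_im, Complex.star_def,
    Complex.conj_re, Complex.conj_im, Complex.ofReal_re, Complex.ofReal_im]
  field_simp
  ring

theorem continuousOn_integrand {a b : ℝ} (ha : 0 < a) (hb : 0 < b) :
    ContinuousOn (fun s : ℝ => s * ((a - b) ^ 2 / ((1 - s) * a + s * b))) (Set.Icc 0 1) :=
  continuousOn_id.mul <| continuousOn_const.div (by fun_prop) fun _ hs => (denom_pos ha hb hs).ne'

theorem integral_integrand {a b : ℝ} (ha : 0 < a) (hb : 0 < b) :
    ∫ s in (0 : ℝ)..1, s * ((a - b) ^ 2 / ((1 - s) * a + s * b)) =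
      a * Real.log a - a * Real.log b - a + b := by
  have h01 : Set.uIcc (0 : ℝ) 1 = Set.Icc 0 1 := Set.uIcc_of_le zero_le_one
  -- With t = (1 - s) a + s b one has a - t = s (a - b), so the integrand is a (a - b) / t - (a -
  -- b), which has this primitive.
  have := intervalIntegral.integral_eq_sub_of_hasDerivAt (a := 0) (b := 1)
    (f := fun s => -a * Real.log ((1 - s) * a + s * b) - s * (a - b))
    (f' := fun s => s * ((a - b) ^ 2 / ((1 - s) * a + s * b))) ?_ ?_
  · rw [this]
    simp
    ring
  · intro s hs
    have hd := denom_pos ha hb (h01 ▸ hs)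
    have h1 : HasDerivAt (fun s : ℝ => (1 - s) * a + s * b) (-1 * a + 1 * b) s :=
      (((hasDerivAt_id s).const_sub 1).mul_const a).add ((hasDerivAt_id s).mul_const b)
    convert! ((h1.log hd.ne').const_mul (-a)).sub ((hasDerivAt_id s).mul_const (a - b)) using 1
    have hd' := hd.ne'
    generalize ht : (1 - s) * a + s * b = t at *
    field_simp
    rw [← ht]
    ring
  · exact ContinuousOn.intervalIntegrable (h01 ▸ continuousOn_integrand ha hb)

theorem continuousOn_quadSup {A B : Matrix n n ℂ} (hA : A.PosDef) (hB : B.PosDef) :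
    ContinuousOn (fun s => s * quadSup hA.1 hB.1 s) (Set.Icc 0 1) := by
  simp only [quadSup, Finset.mul_sum, mul_left_comm _ (Complex.normSq _)]
  exact continuousOn_finsetSum _ fun i _ => continuousOn_finsetSum _ fun j _ =>
    continuousOn_const.mul (continuousOn_integrand (hA.eigenvalues_pos i) (hB.eigenvalues_pos j))

theorem relEntropy_eq_integral {A B : Matrix n n ℂ} (hA : A.PosDef) (hB : B.PosDef) :
    relEntropy A B = (A - B).trace.re + ∫ s in (0 : ℝ)..1, s * quadSup hA.1 hB.1 s := by
  have h01 : Set.uIcc (0 : ℝ) 1 = Set.Icc 0 1 := Set.uIcc_of_le zero_le_one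
  have hint : ∀ i j, IntervalIntegrable (fun s : ℝ => s *
      ((hA.1.eigenvalues i - hB.1.eigenvalues j) ^ 2 /
        ((1 - s) * hA.1.eigenvalues i + s * hB.1.eigenvalues j))) MeasureTheory.volume 0 1 :=
    fun i j => ContinuousOn.intervalIntegrable
      (h01 ▸ continuousOn_integrand (hA.eigenvalues_pos i) (hB.eigenvalues_pos j))
  have cid : ∀ {C : Matrix n n ℂ}, C.IsHermitian → cfc (id : ℝ → ℝ) C = C := fun h => cfc_id ℝ _ h
  have cone : ∀ {C : Matrix n n ℂ}, C.IsHermitian → cfc (fun _ : ℝ => (1 : ℝ)) C = 1 :=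
    fun h => cfc_const_one ℝ _ h
  -- Inserting the constant function 1 for the absent matrix puts all four traces over the same
  -- weights, so the identity can be checked for each pair of eigenvalues.
  have tA := trace_cfc_mul_cfc hA.1 hB.1 id fun _ => 1
  have tB := trace_cfc_mul_cfc hA.1 hB.1 (fun _ => 1) id
  have tAB := trace_cfc_mul_cfc hA.1 hB.1 id Real.log
  have tAA := trace_cfc_mul_cfc hA.1 hB.1 (fun x => x * Real.log x) fun _ => 1
  have hmul : cfc (fun x => x * Real.log x) A = A * cfc Real.log A := by
    have hf : (spectrum ℝ A).Finite := Matrix.finite_real_spectrum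
    exact (cfc_mul (fun x => x) Real.log A (hf.continuousOn _) (hf.continuousOn _)).trans
      (congrArg (· * cfc Real.log A) (cfc_id' ℝ A hA.1))
  rw [cid hA.1, cone hB.1, mul_one] at tA
  rw [cid hB.1, cone hA.1, one_mul] at tB
  rw [cid hA.1] at tAB
  rw [hmul, cone hB.1, mul_one] at tAA
  simp only [quadSup, Finset.mul_sum, mul_left_comm _ (Complex.normSq _)]
  rw [sum_integral _ _ hint]
  simp only [integral_integrand (hA.eigenvalues_pos _) (hB.eigenvalues_pos _)]
  rw [relEntropy, trace_sub, Complex.sub_re, tA, tB, tAB, tAA]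
  simp only [← Finset.sum_add_distrib, ← Finset.sum_sub_distrib]
  refine Finset.sum_congr rfl fun i _ => Finset.sum_congr rfl fun j _ => ?_
  simp only [id]
  ring

/-- The relative entropy does not increase from `(A, B)` to `(A', B')` when every test operator
for `(A', B')` lifts to one for `(A, B)`. -/
theorem relEntropy_le_of_lift {m : Type*} [Fintype m] [DecidableEq m] {A B : Matrix n n ℂ}
    {A' B' : Matrix m m ℂ} (hA : A.PosDef) (hB : B.PosDef) (hA' : A'.PosDef) (hB' : B'.PosDef)
    (htr : (A' - B').trace = (A - B).trace) (φ : Matrix m m ℂ → Matrix n n ℂ)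
    (hφ : ∀ s X, quadTest s A' B' X = quadTest s A B (φ X)) :
    relEntropy A' B' ≤ relEntropy A B := by
  have h01 : Set.uIcc (0 : ℝ) 1 = Set.Icc 0 1 := Set.uIcc_of_le zero_le_one
  rw [relEntropy_eq_integral hA hB, relEntropy_eq_integral hA' hB', htr]
  gcongr
  refine intervalIntegral.integral_mono_on zero_le_one
    (ContinuousOn.intervalIntegrable (h01 ▸ continuousOn_quadSup hA' hB'))
    (ContinuousOn.intervalIntegrable (h01 ▸ continuousOn_quadSup hA hB)) fun s hs => ?_
  -- The lift of an optimal test operator is a competitor in the larger problem, for each s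
  -- separately.
  obtain ⟨X, hX⟩ := exists_quadTest_eq_quadSup hA' hB' hs
  rw [← hX, hφ]
  exact mul_le_mul_of_nonneg_left (quadTest_le_quadSup hA hB hs _) hs.1

/-- Joint convexity of the relative entropy, in the form of joint subadditivity. -/
theorem relEntropy_add_le {A₁ B₁ A₂ B₂ : Matrix n n ℂ} (hA₁ : A₁.PosDef) (hB₁ : B₁.PosDef)
    (hA₂ : A₂.PosDef) (hB₂ : B₂.PosDef) :
    relEntropy (A₁ + A₂) (B₁ + B₂) ≤ relEntropy A₁ B₁ + relEntropy A₂ B₂ := by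
  have h01 : Set.uIcc (0 : ℝ) 1 = Set.Icc 0 1 := Set.uIcc_of_le zero_le_one
  have hA := hA₁.add hA₂
  have hB := hB₁.add hB₂
  have i₁ : IntervalIntegrable _ MeasureTheory.volume (0 : ℝ) 1 :=
    ContinuousOn.intervalIntegrable (h01 ▸ continuousOn_quadSup hA₁ hB₁)
  have i₂ : IntervalIntegrable _ MeasureTheory.volume (0 : ℝ) 1 :=
    ContinuousOn.intervalIntegrable (h01 ▸ continuousOn_quadSup hA₂ hB₂)
  have key := intervalIntegral.integral_mono_on zero_le_one
    (ContinuousOn.intervalIntegrable (h01 ▸ continuousOn_quadSup hA hB)) (i₁.add i₂)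
    fun s hs => by
      obtain ⟨X, hX⟩ := exists_quadTest_eq_quadSup hA hB hs
      -- For fixed X the functional is additive in the pair, so the optimiser of the sum is a
      -- competitor for both summands.
      have e : quadTest s (A₁ + A₂) (B₁ + B₂) X = quadTest s A₁ B₁ X + quadTest s A₂ B₂ X := by
        simp only [quadTest, mul_add, add_mul, mul_sub, trace_add, trace_sub, Complex.add_re,
          Complex.sub_re]
        ring
      rw [← hX, e, mul_add]
      exact add_le_add
        (mul_le_mul_of_nonneg_left (quadTest_le_quadSup hA₁ hB₁ hs _) hs.1)
        (mul_le_mul_of_nonneg_left (quadTest_le_quadSup hA₂ hB₂ hs _) hs.1)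
  rw [intervalIntegral.integral_add i₁ i₂] at key
  rw [relEntropy_eq_integral hA hB, relEntropy_eq_integral hA₁ hB₁,
    relEntropy_eq_integral hA₂ hB₂]
  simp only [trace_sub, trace_add, Complex.sub_re, Complex.add_re] at *
  linarith

end RelativeEntropy

/-! ### Partial traces, extensions by the identity, and monotonicity -/

section PartialTrace

variable {V : Type*} {d : V → ℕ}

theorem restrict_restrict {X Y Z : Finset V} (hYX : Y ⊆ X) (hZY : Z ⊆ Y) (x : Conf d X) :
    restrict hZY (restrict hYX x) = restrict (hZY.trans hYX) x := rfl

variable [DecidableEq V]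

theorem restrict_glue {X Y : Finset V} (hYX : Y ⊆ X) (a : Conf d Y) (c : Conf d (X \ Y)) :
    restrict hYX (glue a c) = a := by
  funext v
  simp [restrict, glue, v.2]

theorem restrict_sdiff_glue {X Y : Finset V} (a : Conf d Y) (c : Conf d (X \ Y)) :
    restrict Finset.sdiff_subset (glue a c) = c := by
  funext v
  simp [restrict, glue, (Finset.mem_sdiff.1 v.2).2]

theorem glue_restrict {X Y : Finset V} (hYX : Y ⊆ X) (x : Conf d X) :
    glue (restrict hYX x) (restrict Finset.sdiff_subset x) = x := by
  funext v
  by_cases h : v.1 ∈ Y <;> simp [restrict, glue, h]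

/-- A basis label of `X` is a basis label of `Y ⊆ X` together with one of `X \ Y`. -/
def glueEquiv {X Y : Finset V} (hYX : Y ⊆ X) : Conf d Y × Conf d (X \ Y) ≃ Conf d X where
  toFun p := glue p.1 p.2
  invFun x := (restrict hYX x, restrict Finset.sdiff_subset x)
  left_inv p := by simp [restrict_glue, restrict_sdiff_glue]
  right_inv x := glue_restrict hYX x

theorem sum_conf {X Y : Finset V} (hYX : Y ⊆ X) {M : Type*} [AddCommMonoid M]
    (f : Conf d X → M) : ∑ x, f x = ∑ a : Conf d Y, ∑ c : Conf d (X \ Y), f (glue a c) := by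
  rw [← Fintype.sum_prod_type', ← (glueEquiv hYX).sum_comp]
  rfl

theorem extend_glue {X Y : Finset V} (hYX : Y ⊆ X) (A : Op d Y) (a b : Conf d Y)
    (c e : Conf d (X \ Y)) :
    extend hYX A (glue a c) (glue b e) = A a b * (1 : Op d (X \ Y)) c e := by
  rw [extend, restrict_glue, restrict_glue, restrict_sdiff_glue, restrict_sdiff_glue]

theorem one_glue {X Y : Finset V} (hYX : Y ⊆ X) (a b : Conf d Y) (c e : Conf d (X \ Y)) :
    (1 : Op d X) (glue a c) (glue b e) = (1 : Op d Y) a b * (1 : Op d (X \ Y)) c e := by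
  have : glue a c = glue b e ↔ a = b ∧ c = e := by
    rw [← Prod.mk.injEq]
    exact (glueEquiv (d := d) hYX).injective.eq_iff (a := (a, c)) (b := (b, e))
  rw [one_apply, one_apply, one_apply, if_congr this rfl rfl]
  by_cases h1 : a = b <;> by_cases h2 : c = e <;> simp [h1, h2]

theorem ext_glue {X Y : Finset V} (hYX : Y ⊆ X) {A B : Op d X}
    (h : ∀ (a b : Conf d Y) (c e : Conf d (X \ Y)),
      A (glue a c) (glue b e) = B (glue a c) (glue b e)) : A = B := by
  ext x y
  rw [← glue_restrict hYX x, ← glue_restrict hYX y]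
  exact h _ _ _ _

/-- The operators `A ⊗ 𝟙` as a unital star homomorphism in `A`. -/
def extendHom {X Y : Finset V} (hYX : Y ⊆ X) : Op d Y →⋆ₐ[ℂ] Op d X where
  toFun := extend hYX
  map_one' := by
    refine ext_glue hYX fun a b c e => ?_
    rw [extend_glue, one_glue hYX]
  map_zero' := by
    ext x y
    simp [extend]
  map_mul' A B := by
    refine ext_glue hYX fun a b c e => ?_
    simp only [extend_glue, mul_apply, sum_conf hYX]
    rw [Finset.sum_mul]
    refine Finset.sum_congr rfl fun a' _ => ?_
    simp only [mul_mul_mul_comm (A a a')]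
    rw [← Finset.mul_sum, ← mul_apply, one_mul]
  map_add' A B := by
    ext x y
    simp [extend, add_mul]
  commutes' r := by
    refine ext_glue hYX fun a b c e => ?_
    rw [extend_glue, Algebra.algebraMap_eq_smul_one, Algebra.algebraMap_eq_smul_one,
      Matrix.smul_apply, Matrix.smul_apply, one_glue hYX, smul_mul_assoc]
  map_star' A := by
    refine ext_glue hYX fun a b c e => ?_
    rw [extend_glue, star_apply, star_apply, extend_glue, star_mul', one_apply, one_apply]
    by_cases h : c = e
    · simp [h]
    · simp [h, Ne.symm h]

theorem extendHom_apply {X Y : Finset V} (hYX : Y ⊆ X) (A : Op d Y) :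
    extendHom hYX A = extend hYX A := rfl

/-- The partial trace as a linear map. -/
def ptraceHom {X Y : Finset V} (hYX : Y ⊆ X) : Op d X →ₗ[ℂ] Op d Y where
  toFun := ptrace hYX
  map_add' A B := by
    ext a b
    simp [ptrace, Finset.sum_add_distrib]
  map_smul' r A := by
    ext a b
    simp [ptrace, Finset.mul_sum]

theorem ptrace_add {X Y : Finset V} (hYX : Y ⊆ X) (A B : Op d X) :
    ptrace hYX (A + B) = ptrace hYX A + ptrace hYX B := map_add (ptraceHom hYX) A B

theorem ptrace_smul {X Y : Finset V} (hYX : Y ⊆ X) (r : ℝ) (A : Op d X) :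
    ptrace hYX (r • A) = r • ptrace hYX A :=
  (ptraceHom hYX).map_smul_of_tower r A

theorem ptrace_sub {X Y : Finset V} (hYX : Y ⊆ X) (A B : Op d X) :
    ptrace hYX (A - B) = ptrace hYX A - ptrace hYX B := map_sub (ptraceHom hYX) A B

theorem continuous_ptrace {X Y : Finset V} (hYX : Y ⊆ X) :
    Continuous (ptrace hYX : Op d X → Op d Y) := by
  refine continuous_pi fun a => continuous_pi fun b => ?_
  exact continuous_finsetSum _ fun c _ => continuous_apply_apply _ _

/-- The partial trace is dual to `A ↦ A ⊗ 𝟙`. -/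
theorem trace_extend_mul {X Y : Finset V} (hYX : Y ⊆ X) (W : Op d Y) (A : Op d X) :
    (extend hYX W * A).trace = (W * ptrace hYX A).trace := by
  simp only [trace, diag_apply, mul_apply, sum_conf hYX, extend_glue, one_apply, ptrace,
    mul_ite, mul_one, mul_zero, ite_mul, zero_mul, Finset.sum_ite_eq, Finset.mem_univ, if_true,
    Finset.mul_sum]
  exact Finset.sum_congr rfl fun a _ => Finset.sum_comm

theorem trace_ptrace {X Y : Finset V} (hYX : Y ⊆ X) (A : Op d X) :
    (ptrace hYX A).trace = A.trace := by
  have := trace_extend_mul hYX 1 A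
  rw [← extendHom_apply, map_one, one_mul, one_mul] at this
  exact this.symm

theorem ptrace_self {X : Finset V} (A : Op d X) : ptrace subset_rfl A = A := by
  have e : X \ X = ∅ := Finset.sdiff_self X
  have : IsEmpty {v // v ∈ X \ X} := ⟨fun v => by simpa [e] using v.2⟩
  ext a b
  have hg : ∀ (a : Conf d X) (c : Conf d (X \ X)), glue a c = a := fun a c => by
    funext v
    simp [glue, v.2]
  simp only [ptrace, hg]
  rw [Finset.sum_const, Finset.card_univ, Fintype.card_unique, one_smul]

theorem eq_of_trace_mul {n : Type*} [Fintype n] [DecidableEq n] {A B : Matrix n n ℂ}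
    (h : ∀ W : Matrix n n ℂ, (W * A).trace = (W * B).trace) : A = B :=
  Matrix.ext_iff_trace_mul_left.2 h

theorem extend_extend {X Y Z : Finset V} (hYX : Y ⊆ X) (hZY : Z ⊆ Y) (W : Op d Z) :
    extend hYX (extend hZY W) = extend (hZY.trans hYX) W := by
  ext x y
  simp only [extend, one_apply, restrict_restrict, mul_assoc]
  congr 1
  -- Since X \ Z is the disjoint union of Y \ Z and X \ Y, the identity on it factors accordingly.
  have : (restrict (Finset.sdiff_subset : X \ Z ⊆ X) x = restrict Finset.sdiff_subset y) ↔
      (restrict ((Finset.sdiff_subset : Y \ Z ⊆ Y).trans hYX) x =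
        restrict (Finset.sdiff_subset.trans hYX) y) ∧
      (restrict (Finset.sdiff_subset : X \ Y ⊆ X) x = restrict Finset.sdiff_subset y) := by
    simp only [funext_iff, restrict, Subtype.forall, Finset.mem_sdiff]
    constructor
    · exact fun h => ⟨fun v hv => h v ⟨hYX hv.1, hv.2⟩,
        fun v hv => h v ⟨hv.1, fun hz => hv.2 (hZY hz)⟩⟩
    · intro h v hv
      by_cases hY : v ∈ Y
      · exact h.1 v ⟨hY, hv.2⟩
      · exact h.2 v ⟨hv.1, hY⟩
  rw [if_congr this rfl rfl]
  split_ifs <;> simp_all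

theorem ptrace_ptrace {X Y Z : Finset V} (hYX : Y ⊆ X) (hZY : Z ⊆ Y) (A : Op d X) :
    ptrace hZY (ptrace hYX A) = ptrace (hZY.trans hYX) A :=
  eq_of_trace_mul fun W => by
    rw [← trace_extend_mul, ← trace_extend_mul, ← trace_extend_mul, extend_extend]

theorem ptrace_eq_sum {X Y : Finset V} (hYX : Y ⊆ X) (A : Op d X) : ptrace hYX A =
    ∑ c : Conf d (X \ Y), A.submatrix (fun a => glue a c) fun a => glue a c := by
  ext a b
  simp [ptrace, Matrix.sum_apply]

theorem posSemidef_ptrace {X Y : Finset V} (hYX : Y ⊆ X) {A : Op d X} (hA : A.PosSemidef) :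
    (ptrace hYX A).PosSemidef := by
  rw [ptrace_eq_sum]
  exact posSemidef_sum _ fun c _ => hA.submatrix _

theorem isHermitian_ptrace {X Y : Finset V} (hYX : Y ⊆ X) {A : Op d X} (hA : A.IsHermitian) :
    (ptrace hYX A).IsHermitian := by
  ext a b
  simp only [conjTranspose_apply, ptrace, star_sum]
  exact Finset.sum_congr rfl fun c _ => hA.apply _ _

/-- Each summand is a principal submatrix, hence positive definite; nonzero local dimensions make
the sum nonempty. -/
theorem posDef_ptrace (hd : ∀ v, 0 < d v) {X Y : Finset V} (hYX : Y ⊆ X) {A : Op d X}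
    (hA : A.PosDef) : (ptrace hYX A).PosDef := by
  rw [ptrace_eq_sum]
  refine posDef_sum ⟨fun v => ⟨0, hd _⟩, Finset.mem_univ _⟩ fun c _ => hA.submatrix fun a b h => ?_
  rw [← restrict_glue hYX a c, h, restrict_glue]

theorem posDef_extend {X Y : Finset V} (hYX : Y ⊆ X) {A : Op d Y} (hA : A.PosDef) :
    (extend hYX A).PosDef := by
  have h : (extend hYX A).PosSemidef := by
    open scoped MatrixOrder in
    obtain ⟨B, hB⟩ := CStarAlgebra.nonneg_iff_eq_star_mul_self.mp hA.posSemidef.nonneg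
    rw [hB, ← extendHom_apply, map_mul, map_star]
    exact posSemidef_conjTranspose_mul_self _
  exact h.posDef_iff_isUnit.2 (hA.isUnit.map (extendHom hYX))

/-- A star homomorphism commutes with the functional calculus. The spectrum is finite, so every f,
in particular the logarithm, is continuous on it. -/
theorem cfc_extend {X Y : Finset V} (hYX : Y ⊆ X) {A : Op d Y} (hA : A.IsHermitian)
    (f : ℝ → ℝ) : cfc f (extend hYX A) = extend hYX (cfc f A) := by
  have hf : (spectrum ℝ A).Finite := Matrix.finite_real_spectrum
  have hA' : IsSelfAdjoint (extendHom hYX A) := IsSelfAdjoint.map hA (extendHom hYX)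
  exact (StarAlgHom.map_cfc (extendHom hYX) f A (hf.continuousOn f)
    (LinearMap.continuous_of_finiteDimensional (extendHom hYX).toAlgHom.toLinearMap) hA hA').symm

/-- Extending from `X` to `X ∪ P` and tracing down to `P` is tracing down to `X ∩ P` and extending
to `P`. -/
theorem ptrace_extend {P Q X Y : Finset V} (hPQ : P ⊆ Q) (hXQ : X ⊆ Q) (hYP : Y ⊆ P)
    (hYX : Y ⊆ X) (hinter : P ∩ X ⊆ Y) (hunion : Q ⊆ P ∪ X) (σ : Op d X) :
    ptrace hPQ (extend hXQ σ) = extend hYP (ptrace hYX σ) := by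
  have hXP : X \ Y ⊆ Q \ P := fun v hv => by
    have := @hinter v
    have := @hXQ v
    simp only [Finset.mem_sdiff, Finset.mem_inter] at *
    tauto
  have hPX : Q \ P ⊆ X \ Y := fun v hv => by
    have := @hunion v
    have := @hYP v
    simp only [Finset.mem_sdiff, Finset.mem_union] at *
    tauto
  -- The two differences contain the same sites but are not syntactically equal, so the labels have
  -- to be transported.
  let e : Conf d (Q \ P) ≃ Conf d (X \ Y) := ⟨restrict hXP, restrict hPX, fun _ => rfl, fun _ => rfl⟩
  ext a b
  simp only [ptrace, extend, Finset.sum_mul]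
  refine Fintype.sum_equiv e _ _ fun c => ?_
  have h1 : ∀ a : Conf d P, restrict hXQ (glue a c) = glue (restrict hYP a) (e c) := fun a => by
    funext v
    have h : v.1 ∈ P ↔ v.1 ∈ Y := ⟨fun h => hinter (Finset.mem_inter.2 ⟨h, v.2⟩), fun h => hYP h⟩
    by_cases hv : v.1 ∈ Y
    · simp [restrict, glue, hv, h.2 hv]
    · simp [restrict, glue, hv, mt h.1 hv, e]
      rfl
  have h2 : (restrict (Finset.sdiff_subset : Q \ X ⊆ Q) (glue a c) =
      restrict Finset.sdiff_subset (glue b c)) ↔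
      restrict (Finset.sdiff_subset : P \ Y ⊆ P) a = restrict Finset.sdiff_subset b := by
    simp only [funext_iff, restrict, Subtype.forall, Finset.mem_sdiff, glue]
    constructor
    · intro h v hv
      have hX : v ∉ X := fun hX => hv.2 (hinter (Finset.mem_inter.2 ⟨hv.1, hX⟩))
      simpa [hv.1] using h v ⟨hPQ hv.1, hX⟩
    · intro h v hv
      by_cases hP : v ∈ P
      · simpa [hP] using h v ⟨hP, fun hY => hv.2 (hYX hY)⟩
      · simp [hP]
  rw [h1, h1, one_apply, one_apply, if_congr h2 rfl rfl]

/-- Monotonicity of the relative entropy under partial traces. -/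
theorem relEntropy_ptrace_le (hd : ∀ v, 0 < d v) {X Y : Finset V} (hYX : Y ⊆ X) {A B : Op d X}
    (hA : A.PosDef) (hB : B.PosDef) :
    relEntropy (ptrace hYX A) (ptrace hYX B) ≤ relEntropy A B := by
  refine relEntropy_le_of_lift hA hB (posDef_ptrace hd hYX hA) (posDef_ptrace hd hYX hB)
    (by rw [← ptrace_sub, trace_ptrace]) (extend hYX) fun s Z => ?_
  have hs : (extend hYX Z)ᴴ = extend hYX Zᴴ := (map_star (extendHom hYX) Z).symm
  have hm : ∀ W W' : Op d Y, extend hYX W * extend hYX W' = extend hYX (W * W') :=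
    fun W W' => (map_mul (extendHom hYX) W W').symm
  -- Cyclicity brings the two extended factors together, so that duality with the partial trace
  -- applies to their product.
  have h1 : (extend hYX Zᴴ * A * extend hYX Z).trace = (Zᴴ * ptrace hYX A * Z).trace := by
    rw [trace_mul_cycle, hm, trace_extend_mul, trace_mul_cycle Zᴴ]
  have h2 : (extend hYX Z * B * extend hYX Zᴴ).trace = (Z * ptrace hYX B * Zᴴ).trace := by
    rw [trace_mul_cycle, hm, trace_extend_mul, trace_mul_cycle Z]
  rw [quadTest, quadTest, hs, h1, h2, trace_extend_mul, ptrace_sub]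

/-! ### Continuity and scaling of the entropy -/

theorem entropy_eq {X : Finset V} {A : Op d X} (hA : A.IsHermitian) :
    entropy A = (cfc Real.negMulLog A).trace.re := by
  have hf : (spectrum ℝ A).Finite := Matrix.finite_real_spectrum
  have h : cfc (fun x => x * Real.log x) A = A * cfc Real.log A :=
    (cfc_mul (fun x => x) Real.log A (hf.continuousOn _) (hf.continuousOn _)).trans
      (congrArg (· * cfc Real.log A) (cfc_id' ℝ A hA))
  have h' : cfc Real.negMulLog A = - cfc (fun x => x * Real.log x) A :=
    (congrArg (cfc · A) (funext fun x => by simp [Real.negMulLog])).trans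
      (cfc_neg (fun x => x * Real.log x) A)
  rw [entropy, h', h, trace_neg, Complex.neg_re]

/-- The logarithm is discontinuous at 0, but -x log x is continuous on ℝ, and so is its functional
calculus on Hermitian matrices. -/
theorem continuousOn_entropy {X : Finset V} :
    ContinuousOn (entropy : Op d X → ℝ) {A | A.IsHermitian} := by
  have h : ContinuousOn (fun A : Op d X => cfc Real.negMulLog A) {A | A.IsHermitian} := by
    open scoped Matrix.Norms.L2Operator in
    exact ContinuousOn.cfc_of_mem_nhdsSet (s := Set.univ) Real.negMulLog Filter.univ_mem
      continuousOn_id (fun A hA => hA) Real.continuous_negMulLog.continuousOn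
  refine ContinuousOn.congr (f := fun A : Op d X => (cfc Real.negMulLog A).trace.re) ?_
    fun A hA => entropy_eq hA
  exact Complex.continuous_re.comp_continuousOn
    ((continuous_id.matrix_trace).comp_continuousOn h)

theorem entropy_smul {X : Finset V} {A : Op d X} (hA : A.IsHermitian) (c : ℝ) :
    entropy (c • A) = c * entropy A + Real.negMulLog c * A.trace.re := by
  have hcA : (c • A).IsHermitian := hA.smul (by simp [IsSelfAdjoint])
  have hf : (spectrum ℝ A).Finite := Matrix.finite_real_spectrum
  have h : cfc Real.negMulLog (c • A) = c • cfc Real.negMulLog A + Real.negMulLog c • A := by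
    have e1 : cfc Real.negMulLog (c • A) = cfc (fun x => Real.negMulLog (c • x)) A :=
      (cfc_comp_smul c Real.negMulLog A ((hf.image _).continuousOn _) hA).symm
    have e2 : (fun x => Real.negMulLog (c • x)) =
        fun x => c * Real.negMulLog x + Real.negMulLog c * x := by
      funext x
      rw [smul_eq_mul, Real.negMulLog_mul]
      ring
    have e3 := cfc_add A (fun x => c * Real.negMulLog x) (fun x => Real.negMulLog c * x)
      (hf.continuousOn _) (hf.continuousOn _)
    have e4 := cfc_const_mul c Real.negMulLog A (hf.continuousOn _)
    have e5 : cfc (fun x => Real.negMulLog c * x) A = Real.negMulLog c • A :=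
      cfc_const_mul_id _ A hA
    rw [e1, e2]
    exact e3.trans (congrArg₂ (· + ·) e4 e5)
  rw [entropy_eq hcA, entropy_eq hA, h]
  simp [trace_add, trace_smul]

end PartialTrace

/-! ### Conditional entropy and density matrices -/

section ConditionalEntropy

variable {V : Type*} [DecidableEq V] {d : V → ℕ}

/-- The logarithm of ρ_Y ⊗ 𝟙 is (log ρ_Y) ⊗ 𝟙, and pairing that with A only sees the partial trace
of A. -/
theorem relEntropy_extend_ptrace {X Y : Finset V} (hYX : Y ⊆ X) {A : Op d X}
    (hA : A.IsHermitian) :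
    relEntropy A (extend hYX (ptrace hYX A)) = entropy (ptrace hYX A) - entropy A := by
  rw [relEntropy, cfc_extend hYX (isHermitian_ptrace hYX hA), trace_mul_comm A (extend _ _),
    trace_extend_mul, trace_mul_comm (cfc _ _), entropy, entropy]
  ring

/-- An inequality between continuous functions of a Hermitian matrix extends from positive
definite to positive semidefinite matrices. -/
theorem le_of_le_posDef {n : Type*} [Fintype n] [DecidableEq n] {f g : Matrix n n ℂ → ℝ}
    (hf : ContinuousOn f {A | A.IsHermitian}) (hg : ContinuousOn g {A | A.IsHermitian})
    (h : ∀ A, A.PosDef → f A ≤ g A) {A : Matrix n n ℂ} (hA : A.PosSemidef) : f A ≤ g A := by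
  have hpos : ∀ ε : ℝ, 0 < ε → (A + ε • (1 : Matrix n n ℂ)).PosDef := fun ε hε =>
    PosDef.posSemidef_add hA (PosDef.one.smul hε)
  have ht : Tendsto (fun ε : ℝ => A + ε • (1 : Matrix n n ℂ)) (𝓝[>] 0)
      (𝓝[{A | A.IsHermitian}] A) := by
    refine tendsto_nhdsWithin_iff.2 ⟨?_, ?_⟩
    · have : Continuous fun ε : ℝ => A + ε • (1 : Matrix n n ℂ) := by fun_prop
      simpa using (this.tendsto 0).mono_left nhdsWithin_le_nhds
    · filter_upwards [self_mem_nhdsWithin] with ε hε using (hpos ε hε).1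
  refine le_of_tendsto_of_tendsto ((hf A hA.1).tendsto.comp ht) ((hg A hA.1).tendsto.comp ht) ?_
  filter_upwards [self_mem_nhdsWithin] with ε hε using h _ (hpos ε hε)

theorem continuousOn_entropy_ptrace {X Y : Finset V} (hYX : Y ⊆ X) :
    ContinuousOn (fun A : Op d X => entropy (ptrace hYX A)) {A | A.IsHermitian} :=
  continuousOn_entropy.comp (continuous_ptrace hYX).continuousOn
    fun _ hA => isHermitian_ptrace hYX hA

/-- Strong subadditivity of the von Neumann entropy on `Q = P ∪ X`, where `P ∩ X = Y`. -/
theorem strong_subadditivity (hd : ∀ v, 0 < d v) {P Q X Y : Finset V} (hPQ : P ⊆ Q) (hXQ : X ⊆ Q)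
    (hYP : Y ⊆ P) (hYX : Y ⊆ X) (hinter : P ∩ X ⊆ Y) (hunion : Q ⊆ P ∪ X) {ρ : Op d Q}
    (hρ : ρ.PosSemidef) :
    entropy ρ - entropy (ptrace hXQ ρ) ≤
      entropy (ptrace hPQ ρ) - entropy (ptrace (hYX.trans hXQ) ρ) := by
  refine le_of_le_posDef (f := fun ρ : Op d Q => entropy ρ - entropy (ptrace hXQ ρ))
    (g := fun ρ : Op d Q => entropy (ptrace hPQ ρ) - entropy (ptrace (hYX.trans hXQ) ρ))
    (continuousOn_entropy.sub (continuousOn_entropy_ptrace _))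
    ((continuousOn_entropy_ptrace _).sub (continuousOn_entropy_ptrace _)) (fun A hA => ?_) hρ
  -- Monotonicity is applied to A against A_X ⊗ 𝟙; tracing the latter down to P gives A_Y ⊗ 𝟙.
  have key := relEntropy_ptrace_le hd hPQ hA (posDef_extend hXQ (posDef_ptrace hd hXQ hA))
  rw [ptrace_extend hPQ hXQ hYP hYX hinter hunion, ptrace_ptrace, ← ptrace_ptrace hPQ hYP,
    relEntropy_extend_ptrace hYP (isHermitian_ptrace hPQ hA.1),
    relEntropy_extend_ptrace hXQ hA.1, ptrace_ptrace] at key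
  linarith

/-- Superadditivity of the conditional entropy of unnormalised states. -/
theorem condEntropy_superadditive (hd : ∀ v, 0 < d v) {X Y : Finset V} (hYX : Y ⊆ X)
    {A B : Op d X} (hA : A.PosSemidef) (hB : B.PosSemidef) :
    entropy A - entropy (ptrace hYX A) + (entropy B - entropy (ptrace hYX B)) ≤
      entropy (A + B) - entropy (ptrace hYX (A + B)) := by
  let S : Op d X → ℝ := fun A => entropy A - entropy (ptrace hYX A)
  have hS : ContinuousOn S {A | A.IsHermitian} :=
    continuousOn_entropy.sub (continuousOn_entropy_ptrace _)
  have hadd : ∀ {B : Op d X}, B.IsHermitian →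
      ContinuousOn (fun A => S (A + B)) {A | A.IsHermitian} := fun {B} hB =>
    hS.comp (continuous_id.add continuous_const).continuousOn fun A hA => IsHermitian.add hA hB
  have hpos : ∀ A B : Op d X, A.PosDef → B.PosDef → S A + S B ≤ S (A + B) := fun A B hA hB => by
    have key := relEntropy_add_le hA (posDef_extend hYX (posDef_ptrace hd hYX hA))
      hB (posDef_extend hYX (posDef_ptrace hd hYX hB))
    have e : extend hYX (ptrace hYX A) + extend hYX (ptrace hYX B) =
        extend hYX (ptrace hYX (A + B)) := by
      rw [ptrace_add]
      exact (map_add (extendHom hYX) _ _).symm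
    rw [e, relEntropy_extend_ptrace hYX hA.1, relEntropy_extend_ptrace hYX hB.1,
      relEntropy_extend_ptrace hYX (hA.add hB).1] at key
    simp only [S]
    linarith
  -- The passage to the semidefinite boundary is made in one argument at a time, here in A with B
  -- still positive definite.
  have hleft : ∀ A B : Op d X, A.PosSemidef → B.PosDef → S A + S B ≤ S (A + B) :=
    fun A B hA hB => le_of_le_posDef (f := fun A => S A + S B) (g := fun A => S (A + B))
      (hS.add continuousOn_const) (hadd hB.1) (fun A hA => hpos A B hA hB) hA
  refine le_of_le_posDef (f := fun B => S A + S B) (g := fun B => S (A + B))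
    (continuousOn_const.add hS) ?_ (fun B hB => hleft A B hA hB) hB
  simpa only [add_comm A] using hadd hA.1

/-- The anomalous terms -c log c · Tr A of the two entropies cancel, because the partial trace
preserves the trace. Homogeneity turns superadditivity into concavity without normalisation. -/
theorem condEntropy_smul {X Y : Finset V} (hYX : Y ⊆ X) {A : Op d X} (hA : A.IsHermitian)
    (c : ℝ) : entropy (c • A) - entropy (ptrace hYX (c • A)) =
      c * (entropy A - entropy (ptrace hYX A)) := by
  rw [ptrace_smul, entropy_smul hA, entropy_smul (isHermitian_ptrace hYX hA), trace_ptrace]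
  ring

/-- The density matrices are the image of the Hilbert–Schmidt unit sphere under B ↦ B*B; entries of
such B have modulus at most 1. -/
theorem isCompact_density (X : Finset V) : IsCompact {ρ : Op d X | IsDensity ρ} := by
  have hK : IsCompact {B : Op d X | (Bᴴ * B).trace = 1} := by
    refine IsCompact.of_isClosed_subset
      (isCompact_univ_pi fun _ => isCompact_univ_pi fun _ => isCompact_closedBall (0 : ℂ) 1)
      (isClosed_eq (by fun_prop) continuous_const) fun B hB i _ j _ => ?_
    have h := congrArg Complex.re (show (Bᴴ * B).trace = 1 from hB)
    simp only [trace, diag_apply, mul_apply, conjTranspose_apply, Complex.re_sum,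
      Complex.one_re] at h
    have e : ∀ z : ℂ, (star z * z).re = ‖z‖ ^ 2 := fun z => by
      rw [← Complex.normSq_eq_norm_sq]
      simp [Complex.normSq_apply]
    simp only [e] at h
    have h1 : ‖B i j‖ ^ 2 ≤ 1 := by
      rw [← h]
      exact (Finset.single_le_sum (f := fun i => ‖B i j‖ ^ 2) (fun _ _ => sq_nonneg _)
        (Finset.mem_univ i)).trans (Finset.single_le_sum (f := fun j => ∑ i, ‖B i j‖ ^ 2)
          (fun _ _ => Finset.sum_nonneg fun _ _ => sq_nonneg _) (Finset.mem_univ j))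
    simpa using (sq_le_one_iff₀ (norm_nonneg _)).1 h1
  have : {ρ : Op d X | IsDensity ρ} = (fun B => Bᴴ * B) '' {B : Op d X | (Bᴴ * B).trace = 1} := by
    ext ρ
    constructor
    · rintro ⟨hρ, htr⟩
      open scoped MatrixOrder in
      obtain ⟨B, rfl⟩ := CStarAlgebra.nonneg_iff_eq_star_mul_self.mp hρ.nonneg
      exact ⟨B, htr, rfl⟩
    · rintro ⟨B, hB, rfl⟩
      exact ⟨posSemidef_conjTranspose_mul_self B, hB⟩
  rw [this]
  exact hK.image (by fun_prop)

theorem exists_isDensity (hd : ∀ v, 0 < d v) (X : Finset V) : ∃ ρ : Op d X, IsDensity ρ := by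
  let x : Conf d X := fun v => ⟨0, hd _⟩
  refine ⟨diagonal (Pi.single x 1), PosSemidef.diagonal ?_, by simp [trace_diagonal]⟩
  rw [Pi.single_nonneg]
  exact zero_le_one

theorem isDensity_ptrace {X Y : Finset V} (hYX : Y ⊆ X) {ρ : Op d X} (hρ : IsDensity ρ) :
    IsDensity (ptrace hYX ρ) :=
  ⟨posSemidef_ptrace hYX hρ.1, by rw [trace_ptrace, hρ.2]⟩

theorem entropy_empty {ρ : Op d ∅} (hρ : IsDensity ρ) : entropy ρ = 0 := by
  have : ρ = 1 := by
    ext a b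
    have h := hρ.2
    rw [trace, Fintype.sum_unique] at h
    rw [Subsingleton.elim a default, Subsingleton.elim b default, one_apply_eq]
    exact h
  rw [entropy_eq hρ.1.1, this, cfc_apply_one]
  simp

theorem isLeast_sInf_image_density (hd : ∀ v, 0 < d v) {X : Finset V} {f : Op d X → ℝ}
    (hf : ContinuousOn f {ρ | ρ.IsHermitian}) :
    IsLeast (f '' {ρ | IsDensity ρ}) (sInf (f '' {ρ | IsDensity ρ})) :=
  ((isCompact_density X).image_of_continuousOn (hf.mono fun _ hρ => hρ.1.1)).isLeast_sInf
    (Set.Nonempty.image f (exists_isDensity hd X))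

end ConditionalEntropy

/-! ### Chain rule and the Markov upper bound -/

section MarkovEntropy

variable {V : Type*} [Fintype V] [DecidableEq V] {d : V → ℕ}

theorem ptrace_reduced {X Y : Finset V} (hYX : Y ⊆ X) (σ : Op d Finset.univ) :
    ptrace hYX (reduced σ X) = reduced σ Y := ptrace_ptrace _ _ _

/-- Conditioning on fewer sites increases the conditional entropy. -/
theorem condEntropy_anti (hd : ∀ v, 0 < d v) {σ : Op d Finset.univ} (hσ : IsDensity σ)
    {k : V} {X Y : Finset V} (hYX : Y ⊆ X) (hk : k ∉ X) :
    condEntropy σ {k} X ≤ condEntropy σ {k} Y := by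
  have key := strong_subadditivity hd (P := {k} ∪ Y) (Q := {k} ∪ X) (X := X) (Y := Y)
    (Finset.union_subset_union_right hYX) Finset.subset_union_right Finset.subset_union_right hYX
    (fun v hv => by
      simp only [Finset.mem_inter, Finset.mem_union, Finset.mem_singleton] at hv
      rcases hv with ⟨rfl | h, h'⟩
      · exact absurd h' hk
      · exact h)
    (Finset.union_subset_union_left Finset.subset_union_left)
    (ρ := reduced σ ({k} ∪ X)) (isDensity_ptrace (Finset.subset_univ _) hσ).1
  rw [ptrace_reduced, ptrace_reduced, ptrace_reduced] at key
  exact key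

/-- The chain rule for the von Neumann entropy. -/
theorem entropy_eq_sum_condEntropy {N : ℕ} (ord : V ≃ Fin N) {σ : Op d Finset.univ}
    (hσ : IsDensity σ) : entropy σ = ∑ k, condEntropy σ {k} (preceding ord k) := by
  -- P i consists of the first i sites; adding site k passes from P (ord k) to P (ord k + 1), so the
  -- conditional entropies telescope.
  let P : ℕ → Finset V := fun i => Finset.univ.filter fun v => (ord v : ℕ) < i
  let f : ℕ → ℝ := fun i => entropy (reduced σ (P i))
  have hcongr : ∀ {X Y : Finset V}, X = Y → entropy (reduced σ X) = entropy (reduced σ Y) := by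
    rintro _ _ rfl
    rfl
  have h0 : f 0 = 0 :=
    (hcongr (by simp [P])).trans (entropy_empty (isDensity_ptrace (Finset.subset_univ ∅) hσ))
  have hN : f N = entropy σ :=
    (hcongr (by simp [P])).trans (congrArg entropy (ptrace_self σ))
  have hk : ∀ k, condEntropy σ {k} (preceding ord k) = f (ord k + 1) - f (ord k) := fun k => by
    refine congrArg₂ (· - ·) (hcongr ?_) (hcongr ?_)
    · ext v
      simp only [preceding, P, Finset.mem_union, Finset.mem_singleton, Finset.mem_filter,
        Finset.mem_univ, true_and, Nat.lt_succ_iff, Fin.lt_def]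
      rw [le_iff_eq_or_lt, Fin.val_inj, ord.apply_eq_iff_eq]
    · ext v
      simp [preceding, P]
  simp only [hk]
  rw [ord.sum_comp (fun i : Fin N => f (i + 1) - f i),
    Fin.sum_univ_eq_sum_range (fun i => f (i + 1) - f i), Finset.sum_range_sub, h0, hN, sub_zero]

/-- The Markov entropy is an upper bound for the von Neumann entropy. -/
theorem entropy_le_markovEntropy (hd : ∀ v, 0 < d v) {N : ℕ} (ord : V ≃ Fin N)
    (nbhd : V → Finset V) {σ : Op d Finset.univ} (hσ : IsDensity σ) :
    entropy σ ≤ markovEntropy ord nbhd σ := by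
  rw [entropy_eq_sum_condEntropy ord hσ]
  exact Finset.sum_le_sum fun k _ =>
    condEntropy_anti hd hσ Finset.inter_subset_left (by simp [preceding])

theorem continuousOn_markovEntropy {N : ℕ} (ord : V ≃ Fin N) (nbhd : V → Finset V) :
    ContinuousOn (fun σ : Op d Finset.univ => markovEntropy ord nbhd σ) {σ | σ.IsHermitian} :=
  continuousOn_finsetSum _ fun _ _ =>
    (continuousOn_entropy_ptrace _).sub (continuousOn_entropy_ptrace _)

theorem continuous_energy (h : (X : Finset V) → Op d X) : Continuous (energy h) :=
  Complex.continuous_re.comp (by fun_prop)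

end MarkovEntropy

/-! ### Locally consistent families -/

section LocalConsistency

variable {V : Type*} {d : V → ℕ} {𝒳 : Finset (Finset V)}

theorem convex_psdCone : Convex ℝ (psdCone d 𝒳) := fun _ hρ _ hσ _ _ ha hb _ X =>
  ((hρ X).smul ha).add ((hσ X).smul hb)

variable [DecidableEq V]

theorem isCompact_locallyConsistentFamilies : IsCompact (locallyConsistentFamilies d 𝒳) := by
  have h1 : IsCompact {ρ : Family d 𝒳 | ∀ X, IsDensity (ρ X)} := by
    simpa [Set.pi] using isCompact_univ_pi fun X : {X // X ∈ 𝒳} => isCompact_density (d := d) X.1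
  have h2 : IsClosed {ρ : Family d 𝒳 | LocallyConsistent ρ} := by
    simp only [LocallyConsistent, Set.ofPred_forall]
    exact isClosed_iInter fun X => isClosed_iInter fun Y => isClosed_eq
      ((continuous_ptrace _).comp (continuous_apply X))
      ((continuous_ptrace _).comp (continuous_apply Y))
  exact h1.inter_right h2

theorem convex_locallyConsistent : Convex ℝ {ρ : Family d 𝒳 | LocallyConsistent ρ} :=
  fun ρ hρ σ hσ a b _ _ _ X Y => by
    simp only [Pi.add_apply, Pi.smul_apply, ptrace_add, ptrace_smul]
    rw [hρ X Y, hσ X Y]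

/-- The real affine subspace of locally consistent families of operators of trace one. -/
def consistentAffineSubspace (d : V → ℕ) (𝒳 : Finset (Finset V)) :
    AffineSubspace ℝ (Family d 𝒳) where
  carrier := {ρ | LocallyConsistent ρ ∧ ∀ X, (ρ X).trace = 1}
  smul_vsub_vadd_mem' c ρ₁ ρ₂ ρ₃ h₁ h₂ h₃ := by
    refine ⟨fun X Y => ?_, fun X => ?_⟩
    · simp only [vsub_eq_sub, vadd_eq_add, Pi.add_apply, Pi.smul_apply, Pi.sub_apply, ptrace_add,
        ptrace_smul, ptrace_sub]
      rw [h₁.1 X Y, h₂.1 X Y, h₃.1 X Y]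
    · simp [trace_add, trace_smul, trace_sub, h₁.2 X, h₂.2 X, h₃.2 X]

theorem locallyConsistentFamilies_eq : locallyConsistentFamilies d 𝒳 =
    psdCone d 𝒳 ∩ (consistentAffineSubspace d 𝒳 : Set (Family d 𝒳)) := by
  ext ρ
  exact ⟨fun hρ => ⟨fun X => (hρ.1 X).1, hρ.2, fun X => (hρ.1 X).2⟩,
    fun hρ => ⟨fun X => ⟨hρ.1 X, hρ.2.2 X⟩, hρ.2.1⟩⟩

theorem LocallyConsistent.ptrace_eq {ρ : Family d 𝒳} (hρ : LocallyConsistent ρ)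
    (X Y : {X // X ∈ 𝒳}) (hYX : Y.1 ⊆ X.1) : ptrace hYX (ρ X) = ρ Y := by
  -- The overlap equals Y only propositionally, while it occurs in the types; a free Z allows the
  -- substitution.
  have key : ∀ (Z : Finset V) (hZX : Z ⊆ X.1) (hZY : Z ⊆ Y.1), Z = Y.1 →
      ptrace hZX (ρ X) = ptrace hZY (ρ Y) → ptrace hYX (ρ X) = ρ Y := by
    rintro Z hZX hZY rfl h
    rw [h, ptrace_self]
  exact key _ _ _ (Finset.inter_eq_right.2 hYX) (hρ X Y)

end LocalConsistency

/-! ### The Markov free energy of families and its convexity -/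

section Families

variable {V : Type*} [Fintype V] [DecidableEq V] {d : V → ℕ} {𝒳 : Finset (Finset V)}
  {N : ℕ} {h : (X : Finset V) → Op d X} {ord : V ≃ Fin N} {nbhd : V → Finset V}

theorem energy_eq_familyEnergy (hs : Suffices 𝒳 h ord nbhd) (σ : Op d Finset.univ) :
    energy h σ = familyEnergy h (fun X : {X // X ∈ 𝒳} => reduced σ X.1) := by
  have h1 : energy h σ = ∑ X : Finset V, (reduced σ X * h X).trace.re := by
    rw [energy, hamiltonian, Finset.mul_sum, trace_sum, Complex.re_sum]
    refine Finset.sum_congr rfl fun X _ => ?_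
    rw [trace_mul_comm, trace_extend_mul, trace_mul_comm]
    rfl
  rw [h1, familyEnergy, Finset.sum_coe_sort 𝒳 fun X => (reduced σ X * h X).trace.re]
  refine (Finset.sum_subset (Finset.subset_univ 𝒳) fun X _ hX => ?_).symm
  rw [not_not.1 (mt (hs.support_mem X) hX), mul_zero, trace_zero, Complex.zero_re]

theorem familyMarkovFreeEnergy_reduced (hs : Suffices 𝒳 h ord nbhd) (T : ℝ)
    (σ : Op d Finset.univ) :
    familyMarkovFreeEnergy hs T (fun X => reduced σ X.1) =
      energy h σ - T * markovEntropy ord nbhd σ := by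
  rw [familyMarkovFreeEnergy, energy_eq_familyEnergy hs]
  rfl

theorem image_consistentFamilies (hs : Suffices 𝒳 h ord nbhd) (T : ℝ) :
    familyMarkovFreeEnergy hs T '' consistentFamilies d 𝒳 =
      markovFreeEnergyValues h ord nbhd T := by
  ext x
  constructor
  · rintro ⟨ρ, ⟨σ, hσ, hρ⟩, rfl⟩
    obtain rfl : ρ = fun X : {X // X ∈ 𝒳} => reduced σ X.1 := funext hρ
    exact ⟨σ, hσ, (familyMarkovFreeEnergy_reduced hs T σ).symm⟩
  · rintro ⟨σ, hσ, rfl⟩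
    exact ⟨_, ⟨σ, hσ, fun _ => rfl⟩, familyMarkovFreeEnergy_reduced hs T σ⟩

theorem consistentFamilies_subset :
    consistentFamilies d 𝒳 ⊆ locallyConsistentFamilies d 𝒳 := by
  rintro ρ ⟨σ, hσ, hρ⟩
  obtain rfl : ρ = fun X : {X // X ∈ 𝒳} => reduced σ X.1 := funext hρ
  exact ⟨fun X => isDensity_ptrace _ hσ, fun X Y => by rw [ptrace_reduced, ptrace_reduced]⟩

theorem continuousOn_familyMarkovFreeEnergy (hs : Suffices 𝒳 h ord nbhd) (T : ℝ) :
    ContinuousOn (familyMarkovFreeEnergy hs T) (locallyConsistentFamilies d 𝒳) := by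
  have hE : ∀ X, ContinuousOn (fun ρ : Family d 𝒳 => entropy (ρ X))
      (locallyConsistentFamilies d 𝒳) := fun X =>
    continuousOn_entropy.comp (continuous_apply X).continuousOn fun ρ hρ => (hρ.1 X).1.1
  have h1 : Continuous (familyEnergy h : Family d 𝒳 → ℝ) :=
    continuous_finsetSum _ fun X _ => Complex.continuous_re.comp (by fun_prop)
  exact h1.continuousOn.sub (continuousOn_const.mul (continuousOn_finsetSum _ fun k _ =>
    (hE _).sub (hE _)))

theorem convexOn_familyMarkovFreeEnergy (hd : ∀ v, 0 < d v) (hs : Suffices 𝒳 h ord nbhd)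
    {T : ℝ} (hT : 0 ≤ T) :
    ConvexOn ℝ (psdCone d 𝒳 ∩ {ρ | LocallyConsistent ρ}) (familyMarkovFreeEnergy hs T) := by
  have hconv : Convex ℝ (psdCone d 𝒳 ∩ {ρ | LocallyConsistent ρ}) :=
    convex_psdCone.inter convex_locallyConsistent
  refine ⟨hconv, fun ρ hρ σ hσ a b ha hb hab => ?_⟩
  have hE : familyEnergy h (a • ρ + b • σ) = a * familyEnergy h ρ + b * familyEnergy h σ := by
    simp only [familyEnergy, Finset.mul_sum, ← Finset.sum_add_distrib]
    refine Finset.sum_congr rfl fun X _ => ?_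
    simp [add_mul, trace_add, trace_smul]
  have hS : a * familyMarkovEntropy hs ρ + b * familyMarkovEntropy hs σ ≤
      familyMarkovEntropy hs (a • ρ + b • σ) := by
    simp only [familyMarkovEntropy, Finset.mul_sum, ← Finset.sum_add_distrib]
    refine Finset.sum_le_sum fun k _ => ?_
    let Q : {X // X ∈ 𝒳} := ⟨_, hs.site_union_shield_mem k⟩
    let M : {X // X ∈ 𝒳} := ⟨_, hs.shield_mem k⟩
    have hMQ : M.1 ⊆ Q.1 := Finset.subset_union_right
    change a * (entropy (ρ Q) - entropy (ρ M)) + b * (entropy (σ Q) - entropy (σ M)) ≤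
      entropy ((a • ρ + b • σ) Q) - entropy ((a • ρ + b • σ) M)
    -- Local consistency replaces each shield operator by a partial trace, and homogeneity absorbs
    -- the coefficients a and b into the operators.
    rw [← hρ.2.ptrace_eq Q M hMQ, ← hσ.2.ptrace_eq Q M hMQ,
      ← (hconv hρ hσ ha hb hab).2.ptrace_eq Q M hMQ, ← condEntropy_smul hMQ (hρ.1 Q).1,
      ← condEntropy_smul hMQ (hσ.1 Q).1]
    exact condEntropy_superadditive hd hMQ ((hρ.1 Q).smul ha) ((hσ.1 Q).smul hb)
  have := mul_le_mul_of_nonneg_left hS hT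
  simp only [familyMarkovFreeEnergy, smul_eq_mul]
  rw [hE]
  linarith

end Families

end MED

end

/-! ### The main theorem -/

theorem mainTheorem1 {V : Type*} [Fintype V] [DecidableEq V]
    -- the sites carry finite-dimensional nonzero Hilbert spaces
    (d : V → ℕ) (hd : ∀ v, 0 < d v)
    -- the terms of the Hamiltonian
    (h : (X : Finset V) → MED.Op d X) (hh : ∀ X, (h X).IsHermitian)
    -- an arbitrary ordering of the sites and arbitrary neighbourhoods
    {N : ℕ} (ord : V ≃ Fin N) (nbhd : V → Finset V)
    -- the regions whose reduced density matrices are the variables of the minimisation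
    (𝒳 : Finset (Finset V)) (hs : MED.Suffices 𝒳 h ord nbhd)
    -- the temperature
    (T : ℝ) (hT : 0 ≤ T) :
    -- the Markov entropy bounds the von Neumann entropy from above
    (∀ ρ : MED.Op d Finset.univ, MED.IsDensity ρ →
      MED.entropy ρ ≤ MED.markovEntropy ord nbhd ρ) ∧
    -- the free energies are attained minima
    IsLeast (MED.freeEnergyValues h T) (MED.freeEnergy h T) ∧
    IsLeast (MED.markovFreeEnergyValues h ord nbhd T) (MED.markovFreeEnergy h ord nbhd T) ∧
    IsLeast (MED.familyMarkovFreeEnergy hs T '' MED.locallyConsistentFamilies d 𝒳)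
      (MED.medFreeEnergy hs T) ∧
    -- the Markov free energy is the minimum over the globally consistent families,
    -- which are locally consistent
    IsLeast (MED.familyMarkovFreeEnergy hs T '' MED.consistentFamilies d 𝒳)
      (MED.markovFreeEnergy h ord nbhd T) ∧
    MED.consistentFamilies d 𝒳 ⊆ MED.locallyConsistentFamilies d 𝒳 ∧
    -- the chain of lower bounds
    MED.medFreeEnergy hs T ≤ MED.markovFreeEnergy h ord nbhd T ∧
    MED.markovFreeEnergy h ord nbhd T ≤ MED.freeEnergy h T ∧
    -- the feasible set is cut out of the positive semidefinite cone by linear equations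
    (∃ A : AffineSubspace ℝ (MED.Family d 𝒳),
      MED.locallyConsistentFamilies d 𝒳 = MED.psdCone d 𝒳 ∩ (A : Set (MED.Family d 𝒳))) ∧
    -- the objective is convex on the feasible set, and even without the normalisation
    ConvexOn ℝ (MED.locallyConsistentFamilies d 𝒳) (MED.familyMarkovFreeEnergy hs T) ∧
    ConvexOn ℝ (MED.psdCone d 𝒳 ∩ {ρ | MED.LocallyConsistent ρ})
      (MED.familyMarkovFreeEnergy hs T) := by
  have hM := MED.isLeast_sInf_image_density hd
    (f := fun ρ => MED.energy h ρ - T * MED.markovEntropy ord nbhd ρ)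
    ((MED.continuous_energy h).continuousOn.sub
      (continuousOn_const.mul (MED.continuousOn_markovEntropy ord nbhd)))
  have hF := MED.isLeast_sInf_image_density hd (f := fun ρ => MED.energy h ρ - T * MED.entropy ρ)
    ((MED.continuous_energy h).continuousOn.sub (continuousOn_const.mul MED.continuousOn_entropy))
  have hΩ : IsLeast (MED.familyMarkovFreeEnergy hs T '' MED.consistentFamilies d 𝒳)
      (MED.markovFreeEnergy h ord nbhd T) := by
    rw [MED.image_consistentFamilies]
    exact hM
  have hMED : IsLeast (MED.familyMarkovFreeEnergy hs T '' MED.locallyConsistentFamilies d 𝒳)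
      (MED.medFreeEnergy hs T) :=
    (MED.isCompact_locallyConsistentFamilies.image_of_continuousOn
      (MED.continuousOn_familyMarkovFreeEnergy hs T)).isLeast_sInf
      ((Set.image_nonempty.1 ⟨_, hΩ.1⟩).mono MED.consistentFamilies_subset |>.image _)
  have hconv := MED.convexOn_familyMarkovFreeEnergy hd hs hT
  have hfeas := MED.locallyConsistentFamilies_eq (d := d) (𝒳 := 𝒳)
  refine ⟨fun ρ hρ => MED.entropy_le_markovEntropy hd ord nbhd hρ, hF, hM, hMED, hΩ,
    MED.consistentFamilies_subset, hMED.2 (Set.image_mono MED.consistentFamilies_subset hΩ.1), ?_,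
    ⟨MED.consistentAffineSubspace d 𝒳, hfeas⟩, hconv.subset ?_ ?_, hconv⟩
  · obtain ⟨ρ, hρ, hρF⟩ := hF.1
    calc MED.markovFreeEnergy h ord nbhd T
        ≤ MED.energy h ρ - T * MED.markovEntropy ord nbhd ρ := hM.2 ⟨ρ, hρ, rfl⟩
      _ ≤ MED.energy h ρ - T * MED.entropy ρ := sub_le_sub_left
          (mul_le_mul_of_nonneg_left (MED.entropy_le_markovEntropy hd ord nbhd hρ) hT) _
      _ = MED.freeEnergy h T := hρF
  · exact fun ρ hρ => ⟨fun X => (hρ.1 X).1, hρ.2⟩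
  · rw [hfeas]
    exact MED.convex_psdCone.inter (MED.consistentAffineSubspace d 𝒳).convex
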